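/- **Notation.** For $k\in\mathbb N_0$ let $h_k(x)=(-1)^k(2^kk!\sqrt\pi)^{-1/2}e^{x^2/2}\frac{d^k}{dx^k}e^{-x^2}$ be the Hermite functions on $\mathbb R$, and for a multi-index $\alpha$ let $\mathbf h_\alpha(x)=\prod_{i=1}^d h_{\alpha_i}(x_i)$ on $\mathbb R^d$. Write $\log_+t=\log(1+|t|)$. For $0<s<\frac12$, $y>0$ and real $x$ with $|x|>1$ put $$P_{s,y}(x)=\sqrt{1-\frac{2}{x^2}\Big(\frac{2s}{y}\log_+(\sqrt2\,x)\Big)^{\frac{2s}{1-2s}}},\qquad L_{s,y}(x)=(1-2s)\Big(\frac{2s}{y}\Big)^{\frac{2s}{1-2s}}\big(\log_+(\sqrt2\,x)\big)^{\frac1{1-2s}},$$ where the square root of a negative number is read as $0$ (this occurs at most for $x$ in a bounded set). **Corollary 1.6.** Let $d\in\mathbb N$, $\kappa>0$, $\beta\in\mathbb R$ and $0<s<\frac12$. Here $\mathbb N=\{1,2,\dots\}$ and $\alpha^\beta=\alpha_1^\beta\cdots\alpha_d^\beta$. (1) For every $y>2^{\frac1{2s}-1}$ there is a constant $C>0$,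 depending only on $d,\kappa,\beta,s,y$, such that for all $x\in\mathbb R^d\setminus[-1,1]^d$ the following series converges and $$\sum_{\alpha\in\mathbb N^d}\frac{e^{-\kappa y\sum_{i=1}^d\alpha_i^{1/(2s)}}}{\alpha^\beta}|\mathbf h_\alpha(x)|^\kappa\le C\prod_{i:\,|x_i|>1}|x_i|\,\big(\log_+(\sqrt2\,x_i)\big)^{-\frac{2s(\kappa/4+\beta)}{1-2s}}e^{-\kappa\left(\frac{x_i^2}{2}P_{s,y}(x_i)-L_{s,y}(x_i)\right)}.$$ (2) For every $0<y\le2^{\frac1{2s}-1}$ there is a constant $C>0$, depending only on $d,\kappa,\beta,s,y$, such that for every continuous function $\theta:(0,2^{\frac1{2s}-1}]\to[0,1]$ with $\theta(r)\le\frac{(2r)^{2s}}2$ for all $r$, and for all $x\in\mathbb R^d\setminus[-1,1]^d$, the series converges and $$\sum_{\alpha\in\mathbb N^d}\frac{e^{-\kappa y\sum_{i=1}^d\alpha_i^{1/(2s)}}}{\alpha^\beta}|\mathbf h_\alpha(x)|^\kappa\le C\prod_{i:\,|x_i|>1}|x_i|\,\big(\log_+(\sqrt2\,x_i)\big)^{-\frac{2s(\kappa/4+\beta)}{1-2s}}e^{-\kappa\,\theta(y)^{\frac1{2s}}\left(\frac{x_i^2}{2}P_{s,y}(x_i)-L_{s,y}(x_i)\right)}.$$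 In particular, if $|x_i|>1$ for every $i$, both products run over all $i=1,\dots,d$. -/

import Mathlib

/-- The Hermite functions on the line,
`h_k(x) = (-1)^k (2^k k! π^(1/2))^(-1/2) e^(x²/2) (d^k/dx^k) e^(-x²)`. -/
noncomputable def hermiteFn (k : ℕ) (x : ℝ) : ℝ :=
  (-1) ^ k * ((2 : ℝ) ^ k * (k.factorial : ℝ) * Real.sqrt Real.pi) ^ (-(1 / 2) : ℝ) *
    Real.exp (x ^ 2 / 2) * iteratedDeriv k (fun t : ℝ => Real.exp (-t ^ 2)) x

/-- The Hermite functions on `ℝ^d`, `h_α(x) = ∏ i, h_{α_i}(x_i)`. -/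
noncomputable def hermiteFnMulti {d : ℕ} (α : Fin d → ℕ) (x : Fin d → ℝ) : ℝ :=
  ∏ i, hermiteFn (α i) (x i)

/-- `log₊ x = log (1 + |x|)`. -/
noncomputable def logPlus (x : ℝ) : ℝ := Real.log (1 + |x|)

/-- `P_{s,y}(x) = √(1 - (2/x²) ((2s/y) log₊(√2 x))^(2s/(1-2s)))`. For moderate `|x|` the number
under the outer root can be negative; the root is then `0`. -/
noncomputable def PFn (s y x : ℝ) : ℝ :=
  Real.sqrt (1 - 2 / x ^ 2 * (2 * s / y * logPlus (Real.sqrt 2 * x)) ^ (2 * s / (1 - 2 * s)))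

/-- `L_{s,y}(x) = (1-2s) (2s/y)^(2s/(1-2s)) (log₊(√2 x))^(1/(1-2s))`. -/
noncomputable def LFn (s y x : ℝ) : ℝ :=
  (1 - 2 * s) * (2 * s / y) ^ (2 * s / (1 - 2 * s)) *
    logPlus (Real.sqrt 2 * x) ^ (1 / (1 - 2 * s))

/-- The term `e^(-κ y ∑ i, α_i^(1/(2s))) α^(-β) |h_α(x)|^κ`, where `α^β = ∏ i, α_i^β` and `α` is
a multi-index with positive entries. -/
noncomputable def hermiteSumTerm {d : ℕ} (κ β s y : ℝ) (x : Fin d → ℝ) (α : Fin d → ℕ+) : ℝ :=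
  Real.exp (-(κ * y * ∑ i, ((α i : ℕ) : ℝ) ^ (1 / (2 * s)))) / (∏ i, ((α i : ℕ) : ℝ) ^ β) *
    |hermiteFnMulti (fun i => (α i : ℕ)) x| ^ κ

/-- The one-dimensional bound with a factor `τ` in the exponent,
`|x| (log₊(√2 x))^(-2s(κ/4+β)/(1-2s)) e^(-κ τ (x²/2 P_{s,y}(x) - L_{s,y}(x)))`. -/
noncomputable def boundFactor (κ β s y τ x : ℝ) : ℝ :=
  |x| * logPlus (Real.sqrt 2 * x) ^ (-(2 * s * (κ / 4 + β) / (1 - 2 * s))) *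
    Real.exp (-(κ * τ * (x ^ 2 / 2 * PFn s y x - LFn s y x)))

/-! The crude estimate `|h_k(x)| ≤ (1 + √2|x|)^k e^(-x²/2)` suffices. With `ℓ = logPlus (√2 x)` it
bounds each term by `n^(-β) e^(κ(nℓ - y n^(1/(2s)) - x²/2))`, and Young's inequality
(`mul_logPlus_le_add_LFn`) bounds `nℓ - y n^(1/(2s))` by `LFn`. Summing over `n` costs only a power
of `ℓ` (`exists_rpow_mul_exp_le`), so the one-dimensional sum is at most `(A + B ℓ^b) e^(-κ(x²/2 -
LFn))`.

For `|x| > 1` the factor `|x|`, comparable to `e^ℓ`, absorbs all powers of `ℓ`. Since `PFn ≤ 1` and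
`x²/2 - LFn` is bounded below, the exponent may be weakened by any `τ ∈ [0, 1]`, which covers both
claims (`τ = 1` and `τ = θ(y)^(1/(2s))`). Terms factor over coordinates, giving dimension `d`. -/

/-! ### Recurrences and pointwise bounds for Hermite functions -/

/-- The three-term recurrence for the derivatives of the Gaussian. -/
theorem iteratedDeriv_gaussian_add_two (k : ℕ) (x : ℝ) :
    iteratedDeriv (k + 2) (fun t : ℝ => Real.exp (-t ^ 2)) x =
      -2 * x * iteratedDeriv (k + 1) (fun t : ℝ => Real.exp (-t ^ 2)) x -
        2 * (k + 1) * iteratedDeriv k (fun t : ℝ => Real.exp (-t ^ 2)) x := by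
  have hsm : ContDiff ℝ (⊤ : ℕ∞) (fun t : ℝ => Real.exp (-t ^ 2)) := by fun_prop
  have hd : ∀ (m : ℕ) (t : ℝ), HasDerivAt (iteratedDeriv m (fun t : ℝ => Real.exp (-t ^ 2)))
      (iteratedDeriv (m + 1) (fun t : ℝ => Real.exp (-t ^ 2)) t) t := by
    intro m t
    rw [iteratedDeriv_succ]
    exact ((hsm.differentiable_iteratedDeriv m (by exact_mod_cast ENat.natCast_lt_top m)) t).hasDerivAt
  have h1 : ∀ t : ℝ, iteratedDeriv 1 (fun t : ℝ => Real.exp (-t ^ 2)) t =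
      -2 * t * Real.exp (-t ^ 2) := by
    intro t
    rw [iteratedDeriv_one]
    have : HasDerivAt (fun t : ℝ => Real.exp (-t ^ 2)) (Real.exp (-t ^ 2) * (-(2 * t))) t := by
      simpa using ((hasDerivAt_pow 2 t).neg).exp
    rw [this.deriv]; ring
  induction k generalizing x with
  | zero =>
    have hF : iteratedDeriv 1 (fun t : ℝ => Real.exp (-t ^ 2)) =
        fun t => -2 * t * iteratedDeriv 0 (fun t : ℝ => Real.exp (-t ^ 2)) t := by
      funext t; rw [h1 t, iteratedDeriv_zero]
    have h2 := hd 1 x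
    have h3 := ((hasDerivAt_id x).const_mul (-2)).mul (hd 0 x)
    rw [hF] at h2
    have := h2.unique h3
    simp only [id, Nat.reduceAdd, zero_add] at this ⊢
    rw [this]; push_cast; ring
  | succ k ih =>
    -- The next identity is the derivative of this one, by uniqueness of derivatives.
    have hF : iteratedDeriv (k + 2) (fun t : ℝ => Real.exp (-t ^ 2)) =
        fun t => -2 * t * iteratedDeriv (k + 1) (fun t : ℝ => Real.exp (-t ^ 2)) t -
        2 * (k + 1) * iteratedDeriv k (fun t : ℝ => Real.exp (-t ^ 2)) t := by
      funext t; exact ih t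
    have h2 := hd (k + 2) x
    have h3 := (((hasDerivAt_id x).const_mul (-2)).mul (hd (k + 1) x)).sub
      ((hd k x).const_mul (2 * ((k : ℝ) + 1)))
    rw [hF] at h2
    have := h2.unique h3
    simp only [id] at this
    rw [show k + 1 + 2 = k + 2 + 1 from rfl, this]
    push_cast; ring

theorem hermiteFn_zero (x : ℝ) :
    hermiteFn 0 x = (Real.sqrt Real.pi) ^ (-(1 / 2) : ℝ) * Real.exp (-x ^ 2 / 2) := by
  unfold hermiteFn
  simp only [pow_zero, Nat.factorial_zero, Nat.cast_one, mul_one, one_mul, iteratedDeriv_zero]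
  rw [mul_assoc, ← Real.exp_add]; congr 2; ring

theorem rpow_neg_half_norm_succ (k : ℕ) :
    ((2 : ℝ) ^ (k + 1) * ((k + 1).factorial : ℝ) * Real.sqrt Real.pi) ^ (-(1 / 2) : ℝ) =
      ((2 : ℝ) ^ k * (k.factorial : ℝ) * Real.sqrt Real.pi) ^ (-(1 / 2) : ℝ) *
        (Real.sqrt (2 * (k + 1)))⁻¹ := by
  have : (2 : ℝ) ^ (k + 1) * ((k + 1).factorial : ℝ) * Real.sqrt Real.pi =
      ((2 : ℝ) ^ k * (k.factorial : ℝ) * Real.sqrt Real.pi) * (2 * (k + 1)) := by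
    rw [Nat.factorial_succ]; push_cast; ring
  rw [this, Real.mul_rpow (by positivity) (by positivity), Real.sqrt_eq_rpow (2 * ((k : ℝ) + 1)),
    Real.rpow_neg (by positivity : (0 : ℝ) ≤ 2 * (k + 1))]

theorem hermiteFn_one (x : ℝ) : hermiteFn 1 x = Real.sqrt 2 * x * hermiteFn 0 x := by
  have h1 : iteratedDeriv 1 (fun t : ℝ => Real.exp (-t ^ 2)) x = -2 * x * Real.exp (-x ^ 2) := by
    rw [iteratedDeriv_one]
    have : HasDerivAt (fun t : ℝ => Real.exp (-t ^ 2)) (Real.exp (-x ^ 2) * (-(2 * x))) x := by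
      simpa using ((hasDerivAt_pow 2 x).neg).exp
    rw [this.deriv]; ring
  have h2 := rpow_neg_half_norm_succ 0
  unfold hermiteFn
  rw [h1, iteratedDeriv_zero]
  rw [zero_add] at h2
  rw [h2]
  simp only [Nat.cast_zero, zero_add, mul_one, pow_zero, pow_one, one_mul]
  have h3 : (Real.sqrt 2)⁻¹ * 2 = Real.sqrt 2 := by
    rw [inv_mul_eq_div, div_eq_iff (by positivity)]; exact (Real.mul_self_sqrt (by norm_num)).symm
  linear_combination (((Nat.factorial 0 : ℝ) * Real.sqrt Real.pi) ^ (-(1 / 2) : ℝ) * x *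
    Real.exp (x ^ 2 / 2) * Real.exp (-x ^ 2)) * h3

/-- The three-term recurrence for the Hermite functions. -/
theorem hermiteFn_add_two (k : ℕ) (x : ℝ) :
    hermiteFn (k + 2) x = 2 * (Real.sqrt (2 * (k + 2)))⁻¹ * x * hermiteFn (k + 1) x -
      2 * (k + 1) * (Real.sqrt (2 * (k + 1)))⁻¹ * (Real.sqrt (2 * (k + 2)))⁻¹ * hermiteFn k x := by
  unfold hermiteFn
  have h1 := rpow_neg_half_norm_succ k
  have h2 := rpow_neg_half_norm_succ (k + 1)
  rw [show ((k + 1 : ℕ) : ℝ) + 1 = k + 2 by push_cast; ring] at h2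
  rw [iteratedDeriv_gaussian_add_two, h2, h1]
  ring

theorem abs_hermiteFn_add_two_le (k : ℕ) (x : ℝ) :
    |hermiteFn (k + 2) x| ≤ Real.sqrt 2 * |x| * |hermiteFn (k + 1) x| + |hermiteFn k x| := by
  have hk : (0 : ℝ) ≤ k := Nat.cast_nonneg k
  have e1 : 2 * (Real.sqrt (2 * (k + 2)))⁻¹ ≤ Real.sqrt 2 := by
    rw [← div_eq_mul_inv, div_le_iff₀ (by positivity), ← Real.sqrt_mul (by norm_num)]
    exact Real.le_sqrt_of_sq_le (by nlinarith)
  have e2 : 2 * (k + 1) * (Real.sqrt (2 * (k + 1)))⁻¹ * (Real.sqrt (2 * (k + 2)))⁻¹ ≤ 1 := by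
    rw [mul_assoc, ← mul_inv, ← div_eq_mul_inv, div_le_one (by positivity),
      ← Real.sqrt_mul (by positivity)]
    exact Real.le_sqrt_of_sq_le (by nlinarith)
  rw [hermiteFn_add_two]
  refine (abs_sub _ _).trans (add_le_add ?_ ?_)
  · rw [abs_mul, abs_mul, abs_of_nonneg (by positivity : 0 ≤ 2 * (Real.sqrt (2 * (k + 2 : ℝ)))⁻¹)]
    gcongr
  · rw [abs_mul, abs_of_nonneg (by positivity)]
    exact mul_le_of_le_one_left (abs_nonneg _) e2

/-- Induction on the recurrence closes because `t(1 + t) + 1 ≤ (1 + t)²` for `t = √2|x| ≥ 0`. -/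
theorem abs_hermiteFn_le_pow (k : ℕ) (x : ℝ) :
    |hermiteFn k x| ≤ (1 + Real.sqrt 2 * |x|) ^ k * Real.exp (-x ^ 2 / 2) := by
  have h0 : |hermiteFn 0 x| ≤ Real.exp (-x ^ 2 / 2) := by
    rw [hermiteFn_zero, abs_of_nonneg (by positivity)]
    refine mul_le_of_le_one_left (by positivity) ?_
    refine Real.rpow_le_one_of_one_le_of_nonpos ?_ (by norm_num)
    exact Real.one_le_sqrt.2 (by linarith [Real.pi_gt_three])
  have ht : 0 ≤ Real.sqrt 2 * |x| := by positivity
  set t := Real.sqrt 2 * |x| with htdef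
  set E := Real.exp (-x ^ 2 / 2)
  have hE : 0 < E := Real.exp_pos _
  induction k using Nat.twoStepInduction with
  | zero => simpa using h0
  | one =>
    rw [hermiteFn_one, abs_mul, abs_mul, abs_of_nonneg (Real.sqrt_nonneg 2), pow_one, ← htdef]
    nlinarith
  | more k ih0 ih1 =>
    refine (abs_hermiteFn_add_two_le k x).trans ?_
    rw [← htdef]
    have hp : 0 < (1 + t) ^ k * E := by positivity
    calc t * |hermiteFn (k + 1) x| + |hermiteFn k x|
        ≤ t * ((1 + t) ^ (k + 1) * E) + (1 + t) ^ k * E := by gcongr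
      _ = (t * (1 + t) + 1) * ((1 + t) ^ k * E) := by ring
      _ ≤ (1 + t) ^ 2 * ((1 + t) ^ k * E) := by gcongr; nlinarith
      _ = _ := by ring

theorem exp_logPlus (x : ℝ) : Real.exp (logPlus (Real.sqrt 2 * x)) = 1 + Real.sqrt 2 * |x| := by
  rw [logPlus, Real.exp_log (by positivity), abs_mul, abs_of_nonneg (Real.sqrt_nonneg 2)]

theorem logPlus_nonneg (x : ℝ) : 0 ≤ logPlus x :=
  Real.log_nonneg (by linarith [abs_nonneg x])

/-- A pointwise bound for the Hermite functions in terms of `logPlus`. -/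
theorem abs_hermiteFn_le (k : ℕ) (x : ℝ) :
    |hermiteFn k x| ≤ Real.exp (k * logPlus (Real.sqrt 2 * x) - x ^ 2 / 2) := by
  refine (abs_hermiteFn_le_pow k x).trans_eq ?_
  rw [← exp_logPlus, ← Real.exp_nat_mul, ← Real.exp_add]
  congr 1; ring

/-! ### The one-dimensional series -/

/-- Young's inequality with the parameters of `LFn`. -/
theorem mul_logPlus_le_add_LFn {s y t : ℝ} (hs0 : 0 < s) (hs : s < 1 / 2) (hy : 0 < y) (ht : 0 ≤ t)
    (x : ℝ) : t * logPlus (Real.sqrt 2 * x) ≤ y * t ^ (1 / (2 * s)) + LFn s y x := by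
  have hℓ := logPlus_nonneg (Real.sqrt 2 * x)
  unfold LFn
  set ℓ := logPlus (Real.sqrt 2 * x)
  have h1 : 0 < 1 - 2 * s := by linarith
  have hpq : (1 / (2 * s)).HolderConjugate (1 / (1 - 2 * s)) := by
    rw [Real.holderConjugate_iff]
    refine ⟨by rw [lt_div_iff₀ (by positivity)]; linarith, ?_⟩
    rw [one_div, one_div, inv_inv, inv_inv]; ring
  -- This weight makes the first Young term exactly `y t^(1/(2s))`, as `2s · c = y`.
  set c := y / (2 * s) with hc
  have hc0 : 0 < c := by positivity
  have hY := Real.young_inequality_of_nonneg (a := t * c ^ (2 * s)) (b := ℓ * c ^ (-(2 * s)))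
    (by positivity) (by positivity) hpq
  have e1 : t * c ^ (2 * s) * (ℓ * c ^ (-(2 * s))) = t * ℓ := by
    rw [Real.rpow_neg hc0.le]; field_simp
  have e2 : (t * c ^ (2 * s)) ^ (1 / (2 * s)) / (1 / (2 * s)) = y * t ^ (1 / (2 * s)) := by
    rw [Real.mul_rpow ht (by positivity), ← Real.rpow_mul hc0.le,
      mul_one_div_cancel (by positivity), Real.rpow_one, hc]
    field_simp
  have e3 : (ℓ * c ^ (-(2 * s))) ^ (1 / (1 - 2 * s)) / (1 / (1 - 2 * s)) =
      (1 - 2 * s) * (2 * s / y) ^ (2 * s / (1 - 2 * s)) * ℓ ^ (1 / (1 - 2 * s)) := by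
    have : 2 * s / y = c⁻¹ := by rw [hc, inv_div]
    rw [Real.mul_rpow hℓ (by positivity), ← Real.rpow_mul hc0.le, this,
      Real.inv_rpow hc0.le, ← Real.rpow_neg hc0.le, div_div_eq_mul_div, div_one]
    rw [show -(2 * s) * (1 / (1 - 2 * s)) = -(2 * s / (1 - 2 * s)) by ring]
    ring
  rw [e1, e2, e3] at hY
  exact hY

/-- The general term of the one-dimensional series. -/
noncomputable def hermiteSumTermOne (κ β s y x : ℝ) (n : ℕ+) : ℝ :=
  Real.exp (-(κ * y * ((n : ℕ) : ℝ) ^ (1 / (2 * s)))) / ((n : ℕ) : ℝ) ^ β *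
    |hermiteFn n x| ^ κ

theorem hermiteSumTermOne_nonneg (κ β s y x : ℝ) (n : ℕ+) : 0 ≤ hermiteSumTermOne κ β s y x n := by
  unfold hermiteSumTermOne; positivity

theorem hermiteSumTerm_eq_prod {d : ℕ} (κ β s y : ℝ) (x : Fin d → ℝ) (α : Fin d → ℕ+) :
    hermiteSumTerm κ β s y x α = ∏ i, hermiteSumTermOne κ β s y (x i) (α i) := by
  unfold hermiteSumTerm hermiteSumTermOne hermiteFnMulti
  rw [Finset.prod_mul_distrib, Finset.prod_div_distrib, ← Real.exp_sum, Finset.abs_prod,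
    Real.finsetProd_rpow _ _ (fun i _ => abs_nonneg _), Finset.sum_neg_distrib, Finset.mul_sum]

theorem hermiteSumTermOne_le {κ s y : ℝ} (hκ : 0 < κ) (β x : ℝ) (n : ℕ+) :
    hermiteSumTermOne κ β s y x n ≤ Real.exp (-(κ * (x ^ 2 / 2))) * (((n : ℕ) : ℝ) ^ (-β) *
      Real.exp (κ * (n * logPlus (Real.sqrt 2 * x) - y * ((n : ℕ) : ℝ) ^ (1 / (2 * s))))) := by
  unfold hermiteSumTermOne
  have h := Real.rpow_le_rpow (abs_nonneg _) (abs_hermiteFn_le n x) hκ.le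
  rw [← Real.exp_mul] at h
  have hn : (0 : ℝ) < (n : ℕ) := by exact_mod_cast n.pos
  calc _ ≤ Real.exp (-(κ * y * ((n : ℕ) : ℝ) ^ (1 / (2 * s)))) / ((n : ℕ) : ℝ) ^ β *
        Real.exp ((n * logPlus (Real.sqrt 2 * x) - x ^ 2 / 2) * κ) := by gcongr
    _ = ((n : ℕ) : ℝ) ^ (-β) * (Real.exp (-(κ * y * ((n : ℕ) : ℝ) ^ (1 / (2 * s)))) *
        Real.exp ((n * logPlus (Real.sqrt 2 * x) - x ^ 2 / 2) * κ)) := by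
      rw [Real.rpow_neg hn.le]; ring
    _ = ((n : ℕ) : ℝ) ^ (-β) * (Real.exp (-(κ * (x ^ 2 / 2))) *
        Real.exp (κ * (n * logPlus (Real.sqrt 2 * x) - y * ((n : ℕ) : ℝ) ^ (1 / (2 * s))))) := by
      rw [← Real.exp_add, ← Real.exp_add]; congr 2; ring
    _ = _ := by ring

/-- Powers are dominated by the exponential away from zero. -/
theorem exists_rpow_le_mul_exp (c : ℝ) :
    ∃ C : ℝ, 0 < C ∧ ∀ t : ℝ, 1 / 2 ≤ t → t ^ c ≤ C * Real.exp t := by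
  rcases le_or_gt c 0 with hc | hc
  · refine ⟨(1 / 2) ^ c, by positivity, fun t ht => ?_⟩
    calc t ^ c ≤ (1 / 2) ^ c := Real.rpow_le_rpow_of_nonpos (by norm_num) ht hc
      _ ≤ _ := le_mul_of_one_le_right (by positivity) (Real.one_le_exp (by linarith))
  · refine ⟨c ^ c, by positivity, fun t ht => ?_⟩
    calc t ^ c = (c * (t / c)) ^ c := by rw [mul_div_cancel₀ _ hc.ne']
      _ = c ^ c * (t / c) ^ c := Real.mul_rpow hc.le (by positivity)
      _ ≤ c ^ c * Real.exp (t / c) ^ c := by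
        have := Real.add_one_le_exp (t / c)
        gcongr
        linarith
      _ = c ^ c * Real.exp t := by rw [← Real.exp_mul, div_mul_cancel₀ _ hc.ne']

theorem summable_pnat_rpow_neg_two : Summable fun n : ℕ+ => ((n : ℕ) : ℝ) ^ (-2 : ℝ) :=
  (Real.summable_nat_rpow.2 (by norm_num)).comp_injective PNat.coe_injective

/-- Uniformly in the parameter, the series deviates from its largest term by a power. -/
theorem exists_rpow_mul_exp_le {κ s y : ℝ} (hκ : 0 < κ) (hs0 : 0 < s) (hs : s < 1 / 2)
    (hy : 0 < y) (β : ℝ) : ∃ A B b : ℝ, 0 < A ∧ 0 < B ∧ 0 ≤ b ∧ ∀ (x : ℝ) (n : ℕ+),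
      ((n : ℕ) : ℝ) ^ (-β) *
        Real.exp (κ * (n * logPlus (Real.sqrt 2 * x) - y * ((n : ℕ) : ℝ) ^ (1 / (2 * s)))) ≤
      Real.exp (κ * LFn s y x) * (A + B * logPlus (Real.sqrt 2 * x) ^ b) *
        ((n : ℕ) : ℝ) ^ (-2 : ℝ) := by
  have h1 : 0 < 1 - 2 * s := by linarith
  have hp1 : 0 < 1 / (2 * s) - 1 := by
    rw [sub_pos, lt_div_iff₀ (by positivity)]; linarith
  set p := 1 / (2 * s) with hp
  have hp0 : 0 < p := by linarith
  set m := (κ * y / 2) with hm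
  have hm0 : 0 < m := by positivity
  set b := (2 + |β|) / (p - 1) with hb
  have hb0 : 0 ≤ b := by positivity
  obtain ⟨A, hA, hAe⟩ : ∃ A : ℝ, 0 < A ∧ ∀ t : ℝ, 1 ≤ t →
      t ^ (2 + |β|) * Real.exp (-(m * t ^ p)) ≤ A := by
    -- The witness comes from `v ≤ e^v` at `v = m t^p / c`, raised to the power `c = (2 + |β|)/p`.
    refine ⟨((2 + |β|) / p / m) ^ ((2 + |β|) / p), by positivity, fun t ht => ?_⟩
    have ht0 : 0 < t := by linarith
    set c := (2 + |β|) / p with hc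
    have hc0 : 0 < c := by positivity
    set u := t ^ p
    have hu : 0 < u := by positivity
    have e : t ^ (2 + |β|) = u ^ c := by
      rw [← Real.rpow_mul ht0.le, hc, mul_div_cancel₀ _ hp0.ne']
    have : u ≤ c / m * Real.exp (m * u / c) := by
      have := Real.add_one_le_exp (m * u / c)
      calc u = c / m * (m * u / c) := by field_simp
        _ ≤ _ := by gcongr; linarith
    rw [e, Real.exp_neg, ← div_eq_mul_inv, div_le_iff₀ (by positivity)]
    calc u ^ c ≤ (c / m * Real.exp (m * u / c)) ^ c := by gcongr
      _ = (c / m) ^ c * Real.exp (m * u) := by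
        rw [Real.mul_rpow (by positivity) (by positivity), ← Real.exp_mul,
          div_mul_cancel₀ _ hc0.ne']
  refine ⟨A, (2 / y) ^ b, b, hA, by positivity, hb0, fun x n => ?_⟩
  have hℓ := logPlus_nonneg (Real.sqrt 2 * x)
  have hn1 : (1 : ℝ) ≤ (n : ℕ) := by exact_mod_cast one_le (a := n)
  have hY := mul_logPlus_le_add_LFn hs0 hs hy (by linarith : (0 : ℝ) ≤ (n : ℕ)) x
  have hL : 0 ≤ LFn s y x := by unfold LFn; positivity
  rw [← hp] at hY
  set ℓ := logPlus (Real.sqrt 2 * x)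
  set N : ℝ := ((n : ℕ) : ℝ)
  have hN0 : 0 < N := by linarith
  have hβ : N ^ (-β) ≤ N ^ (2 + |β|) * N ^ (-2 : ℝ) := by
    rw [← Real.rpow_add hN0]
    exact Real.rpow_le_rpow_of_exponent_le hn1 (by linarith [neg_abs_le β, neg_le_abs β])
  have hE1 : 1 ≤ Real.exp (κ * LFn s y x) := Real.one_le_exp (by positivity)
  have hB0 : 0 ≤ (2 / y) ^ b * ℓ ^ b := by positivity
  have key : N ^ (2 + |β|) * Real.exp (κ * (N * ℓ - y * N ^ p)) ≤
      Real.exp (κ * LFn s y x) * (A + (2 / y) ^ b * ℓ ^ b) := by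
    -- Large `N`: half of `y N^p` dominates `Nℓ`, and the other half kills the power of `N`. Small
    -- `N`: the power of `N` is at most a power of `ℓ`, and Young bounds the exponential.
    rcases le_or_gt (2 * ℓ / y) (N ^ (p - 1)) with h | h
    · have h2 : N * ℓ ≤ y / 2 * N ^ p := by
        have e : N ^ p = N ^ (p - 1) * N := by
          rw [← Real.rpow_add_one hN0.ne']; congr 1; ring
        rw [div_le_iff₀ hy] at h
        rw [e]; nlinarith
      calc _ ≤ N ^ (2 + |β|) * Real.exp (-(m * N ^ p)) := by
            gcongr
            rw [hm]; nlinarith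
        _ ≤ A := hAe N hn1
        _ ≤ 1 * (A + (2 / y) ^ b * ℓ ^ b) := by linarith
        _ ≤ _ := by gcongr
    · have h2 : N ^ (2 + |β|) ≤ (2 / y) ^ b * ℓ ^ b := by
        rw [← Real.mul_rpow (by positivity) hℓ]
        calc N ^ (2 + |β|) = (N ^ (p - 1)) ^ b := by
              rw [← Real.rpow_mul hN0.le, hb, mul_div_cancel₀ _ hp1.ne']
          _ ≤ (2 / y * ℓ) ^ b := by
            refine Real.rpow_le_rpow (by positivity) ?_ hb0
            calc _ ≤ _ := h.le
              _ = _ := by ring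
      rw [mul_comm]
      have h3 : Real.exp (κ * (N * ℓ - y * N ^ p)) ≤ Real.exp (κ * LFn s y x) := by
        gcongr; linarith
      have h4 : N ^ (2 + |β|) ≤ A + (2 / y) ^ b * ℓ ^ b := by linarith
      gcongr
  calc _ ≤ N ^ (2 + |β|) * N ^ (-2 : ℝ) * Real.exp (κ * (N * ℓ - y * N ^ p)) := by gcongr
    _ = N ^ (2 + |β|) * Real.exp (κ * (N * ℓ - y * N ^ p)) * N ^ (-2 : ℝ) := by ring
    _ ≤ _ := by gcongr

/-- The one-dimensional series converges, and is bounded by its formal maximal term up to a power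
of `logPlus`. -/
theorem exists_tsum_hermiteSumTermOne_le {κ s y : ℝ} (hκ : 0 < κ) (hs0 : 0 < s) (hs : s < 1 / 2)
    (hy : 0 < y) (β : ℝ) : ∃ A B b : ℝ, 0 < A ∧ 0 < B ∧ 0 ≤ b ∧ ∀ x : ℝ,
      Summable (hermiteSumTermOne κ β s y x) ∧ ∑' n, hermiteSumTermOne κ β s y x n ≤
        (A + B * logPlus (Real.sqrt 2 * x) ^ b) * Real.exp (-(κ * (x ^ 2 / 2 - LFn s y x))) := by
  obtain ⟨A, B, b, hA, hB, hb, h⟩ := exists_rpow_mul_exp_le hκ hs0 hs hy β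
  set S := ∑' n : ℕ+, ((n : ℕ) : ℝ) ^ (-2 : ℝ) with hS
  have hS0 : 0 < S := by
    refine summable_pnat_rpow_neg_two.tsum_pos (fun n => by positivity) 1 ?_
    simp
  refine ⟨A * S, B * S, b, by positivity, by positivity, hb, fun x => ?_⟩
  have hle : ∀ n : ℕ+, hermiteSumTermOne κ β s y x n ≤
      (A + B * logPlus (Real.sqrt 2 * x) ^ b) * Real.exp (-(κ * (x ^ 2 / 2 - LFn s y x))) *
        ((n : ℕ) : ℝ) ^ (-2 : ℝ) := by
    intro n
    refine (hermiteSumTermOne_le hκ β x n).trans ?_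
    calc _ ≤ Real.exp (-(κ * (x ^ 2 / 2))) * _ := mul_le_mul_of_nonneg_left (h x n) (by positivity)
      _ = _ := by
        rw [show -(κ * (x ^ 2 / 2 - LFn s y x)) = -(κ * (x ^ 2 / 2)) + κ * LFn s y x by ring,
          Real.exp_add]
        ring
  have hsum := summable_pnat_rpow_neg_two.mul_left
    ((A + B * logPlus (Real.sqrt 2 * x) ^ b) * Real.exp (-(κ * (x ^ 2 / 2 - LFn s y x))))
  have hs' := Summable.of_nonneg_of_le (hermiteSumTermOne_nonneg κ β s y x) hle hsum
  refine ⟨hs', (hs'.tsum_le_tsum hle hsum).trans_eq ?_⟩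
  rw [tsum_mul_left, ← hS]; ring

/-! ### Comparison with the target bound -/

theorem logPlus_le_logPlus {x z : ℝ} (h : |x| ≤ |z|) : logPlus x ≤ logPlus z :=
  Real.log_le_log (by positivity) (by linarith)

theorem half_le_logPlus {x : ℝ} (hx : 1 < |x|) : 1 / 2 ≤ logPlus (Real.sqrt 2 * x) := by
  rw [← Real.exp_le_exp, exp_logPlus]
  have h1 : (1 : ℝ) ≤ Real.sqrt 2 := Real.one_le_sqrt.2 (by norm_num)
  have h2 : Real.exp (1 / 2) ≤ 2 := by
    have : Real.exp (1 / 2) ^ 2 ≤ 2 ^ 2 := by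
      rw [← Real.exp_nat_mul]
      have := Real.exp_one_lt_d9
      norm_num
      linarith
    exact le_of_sq_le_sq this (by norm_num)
  nlinarith

/-- On a bounded interval the one-dimensional series is uniformly bounded. -/
theorem exists_tsum_hermiteSumTermOne_le_of_abs_le_one {κ s y : ℝ} (hκ : 0 < κ) (hs0 : 0 < s)
    (hs : s < 1 / 2) (hy : 0 < y) (β : ℝ) : ∃ C : ℝ, 0 < C ∧ ∀ x : ℝ, |x| ≤ 1 →
      ∑' n, hermiteSumTermOne κ β s y x n ≤ C := by
  obtain ⟨A, B, b, hA, hB, hb, h⟩ := exists_tsum_hermiteSumTermOne_le hκ hs0 hs hy β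
  have hℓ1 := logPlus_nonneg (Real.sqrt 2 * 1)
  refine ⟨(A + B * logPlus (Real.sqrt 2 * 1) ^ b) * Real.exp (κ * LFn s y 1), by positivity,
    fun x hx => (h x).2.trans ?_⟩
  have hℓ := logPlus_nonneg (Real.sqrt 2 * x)
  have hm : logPlus (Real.sqrt 2 * x) ≤ logPlus (Real.sqrt 2 * 1) := by
    apply logPlus_le_logPlus
    rw [abs_mul, abs_mul, abs_one]
    gcongr
  have h1 : 0 < 1 - 2 * s := by linarith
  have hL : LFn s y x ≤ LFn s y 1 := by
    unfold LFn
    gcongr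
  have hx2 : 0 ≤ κ * (x ^ 2 / 2) := by positivity
  gcongr
  nlinarith

/-- `LFn` is a power of a logarithm, hence at most linear in `|x|` up to constants. This lower bound
on `x²/2 - LFn` is what permits a factor `τ < 1`. -/
theorem exists_LFn_le {s y : ℝ} (hs0 : 0 < s) (hs : s < 1 / 2) (hy : 0 < y) :
    ∃ K : ℝ, 0 < K ∧ ∀ x : ℝ, 1 < |x| → LFn s y x ≤ x ^ 2 / 2 + K := by
  obtain ⟨C, hC, h⟩ := exists_rpow_le_mul_exp (1 / (1 - 2 * s))
  have h1 : 0 < 1 - 2 * s := by linarith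
  set c := (1 - 2 * s) * (2 * s / y) ^ (2 * s / (1 - 2 * s)) with hc
  have hc0 : 0 < c := by positivity
  -- The square comes from `√2 cC|x| ≤ x²/2 + (cC)²`.
  refine ⟨c * C + (c * C) ^ 2, by positivity, fun x hx => ?_⟩
  have h2 := h _ (half_le_logPlus hx)
  rw [exp_logPlus] at h2
  have h3 : LFn s y x ≤ c * (C * (1 + Real.sqrt 2 * |x|)) := by
    unfold LFn; rw [← hc]; gcongr
  have h4 : Real.sqrt 2 ^ 2 = 2 := Real.sq_sqrt (by norm_num)
  have h5 : |x| ^ 2 = x ^ 2 := sq_abs x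
  nlinarith [sq_nonneg (Real.sqrt 2 * (c * C) - |x|)]

theorem boundFactor_pos {κ β s y τ x : ℝ} (hx : 1 < |x|) : 0 < boundFactor κ β s y τ x := by
  have := half_le_logPlus hx
  have h2 : 0 < logPlus (Real.sqrt 2 * x) := by linarith
  unfold boundFactor; positivity

/-- Outside the unit interval the one-dimensional series is bounded by `boundFactor`, uniformly in
the factor `τ ∈ [0, 1]`. -/
theorem exists_tsum_hermiteSumTermOne_le_boundFactor {κ s y : ℝ} (hκ : 0 < κ) (hs0 : 0 < s)
    (hs : s < 1 / 2) (hy : 0 < y) (β : ℝ) : ∃ C : ℝ, 0 < C ∧ ∀ τ ∈ Set.Icc (0 : ℝ) 1,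
      ∀ x : ℝ, 1 < |x| →
        ∑' n, hermiteSumTermOne κ β s y x n ≤ C * boundFactor κ β s y τ x := by
  obtain ⟨A, B, b, hA, hB, hb, h⟩ := exists_tsum_hermiteSumTermOne_le hκ hs0 hs hy β
  obtain ⟨K, hK, hKL⟩ := exists_LFn_le hs0 hs hy
  set a := 2 * s * (κ / 4 + β) / (1 - 2 * s) with ha
  obtain ⟨C₁, hC₁, h₁⟩ := exists_rpow_le_mul_exp a
  obtain ⟨C₂, hC₂, h₂⟩ := exists_rpow_le_mul_exp (b + a)
  refine ⟨(A * C₁ + B * C₂) * 3 * Real.exp (κ * K), by positivity, fun τ hτ x hx => ?_⟩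
  refine (h x).2.trans ?_
  have hℓ := half_le_logPlus hx
  have hL := hKL x hx
  have hx0 : 0 < |x| := by linarith
  have hexp : Real.exp (logPlus (Real.sqrt 2 * x)) ≤ 3 * |x| := by
    rw [exp_logPlus]
    have : Real.sqrt 2 ≤ 2 := Real.sqrt_le_iff.2 ⟨by norm_num, by norm_num⟩
    nlinarith
  have hP : PFn s y x ≤ 1 := by
    have := logPlus_nonneg (Real.sqrt 2 * x)
    unfold PFn
    refine Real.sqrt_le_one.2 ?_
    have : 0 ≤ 2 / x ^ 2 * (2 * s / y * logPlus (Real.sqrt 2 * x)) ^ (2 * s / (1 - 2 * s)) := by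
      positivity
    linarith
  unfold boundFactor
  rw [← ha]
  have h₁' := h₁ _ hℓ
  have h₂' := h₂ _ hℓ
  set ℓ := logPlus (Real.sqrt 2 * x)
  have hℓ0 : 0 < ℓ := by linarith
  have hpoly : A + B * ℓ ^ b ≤ (A * C₁ + B * C₂) * 3 * (|x| * ℓ ^ (-a)) := by
    rw [Real.rpow_neg hℓ0.le, ← div_eq_mul_inv, mul_div_assoc', le_div_iff₀ (by positivity)]
    calc (A + B * ℓ ^ b) * ℓ ^ a = A * ℓ ^ a + B * ℓ ^ (b + a) := by
          rw [Real.rpow_add hℓ0]; ring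
      _ ≤ A * (C₁ * Real.exp ℓ) + B * (C₂ * Real.exp ℓ) := by gcongr
      _ = (A * C₁ + B * C₂) * Real.exp ℓ := by ring
      _ ≤ (A * C₁ + B * C₂) * (3 * |x|) := by gcongr
      _ = _ := by ring
  -- Split `LFn - x²/2` with weights `τ` and `1 - τ`: use `PFn ≤ 1` in the first part and the bound
  -- by `K` in the second.
  have hE : Real.exp (-(κ * (x ^ 2 / 2 - LFn s y x))) ≤
      Real.exp (κ * K) * Real.exp (-(κ * τ * (x ^ 2 / 2 * PFn s y x - LFn s y x))) := by
    rw [← Real.exp_add]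
    gcongr
    have e1 : τ * (x ^ 2 / 2 * PFn s y x) ≤ τ * (x ^ 2 / 2) :=
      mul_le_mul_of_nonneg_left (mul_le_of_le_one_right (by positivity) hP) hτ.1
    have e2 : (1 - τ) * LFn s y x ≤ (1 - τ) * (x ^ 2 / 2 + K) :=
      mul_le_mul_of_nonneg_left hL (by linarith [hτ.2])
    have e3 : 0 ≤ τ * K := mul_nonneg hτ.1 hK.le
    have e4 : LFn s y x - x ^ 2 / 2 ≤ K - τ * (x ^ 2 / 2 * PFn s y x - LFn s y x) := by
      linarith
    have := mul_le_mul_of_nonneg_left e4 hκ.le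
    linarith
  calc _ ≤ ((A * C₁ + B * C₂) * 3 * (|x| * ℓ ^ (-a))) * (Real.exp (κ * K) *
        Real.exp (-(κ * τ * (x ^ 2 / 2 * PFn s y x - LFn s y x)))) := by gcongr
    _ = _ := by ring

/-! ### Passage to several variables -/

/-- A series of products of nonnegative terms over multi-indices is at most the product of the
one-dimensional sums. -/
theorem summable_and_tsum_prod_le {d : ℕ} {ι : Type*} {f : Fin d → ι → ℝ}
    (h0 : ∀ i n, 0 ≤ f i n) (hf : ∀ i, Summable (f i)) :
    Summable (fun α : Fin d → ι => ∏ i, f i (α i)) ∧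
      ∑' α : Fin d → ι, ∏ i, f i (α i) ≤ ∏ i, ∑' n, f i n := by
  classical
  have hnn : ∀ α : Fin d → ι, 0 ≤ ∏ i, f i (α i) := fun α => Finset.prod_nonneg fun i _ => h0 i _
  have hfin : ∀ u : Finset (Fin d → ι), ∑ α ∈ u, ∏ i, f i (α i) ≤ ∏ i, ∑' n, f i n := by
    intro u
    -- A finite set of multi-indices lies in the box of its projections, where the sum factors.
    have hsub : u ⊆ Fintype.piFinset fun i => u.image fun α => α i := fun α hα =>
      Fintype.mem_piFinset.2 fun i => Finset.mem_image_of_mem _ hα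
    calc _ ≤ ∑ α ∈ Fintype.piFinset fun i => u.image fun α => α i, ∏ i, f i (α i) :=
          Finset.sum_le_sum_of_subset_of_nonneg hsub fun α _ _ => hnn α
      _ = ∏ i, ∑ n ∈ u.image fun α => α i, f i n := (Finset.prod_univ_sum _ _).symm
      _ ≤ _ := Finset.prod_le_prod (fun i _ => Finset.sum_nonneg fun n _ => h0 i n)
          fun i _ => (hf i).sum_le_tsum _ fun n _ => h0 i n
  exact ⟨summable_of_sum_le hnn hfin, Real.tsum_le_of_sum_le hnn hfin⟩

/-- The multi-dimensional bound, for every `y > 0` and uniformly in `τ ∈ [0, 1]`. -/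
theorem exists_tsum_hermiteSumTerm_le (d : ℕ) {κ s y : ℝ} (hκ : 0 < κ) (hs0 : 0 < s)
    (hs : s < 1 / 2) (hy : 0 < y) (β : ℝ) : ∃ C : ℝ, 0 < C ∧ ∀ τ ∈ Set.Icc (0 : ℝ) 1,
      ∀ x : Fin d → ℝ, Summable (hermiteSumTerm κ β s y x) ∧
        ∑' α : Fin d → ℕ+, hermiteSumTerm κ β s y x α ≤
          C * ∏ i with 1 < |x i|, boundFactor κ β s y τ (x i) := by
  obtain ⟨_, _, _, _, _, _, hsum⟩ := exists_tsum_hermiteSumTermOne_le hκ hs0 hs hy β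
  obtain ⟨C₁, hC₁, h₁⟩ := exists_tsum_hermiteSumTermOne_le_of_abs_le_one hκ hs0 hs hy β
  obtain ⟨C₂, hC₂, h₂⟩ := exists_tsum_hermiteSumTermOne_le_boundFactor hκ hs0 hs hy β
  -- One constant per coordinate: `C₁` serves `|x i| ≤ 1`, `C₂` serves `|x i| > 1`.
  refine ⟨max C₁ C₂ ^ d, by positivity, fun τ hτ x => ?_⟩
  obtain ⟨hS, hT⟩ := summable_and_tsum_prod_le
    (fun i => hermiteSumTermOne_nonneg κ β s y (x i)) (fun i => (hsum (x i)).1)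
  have hfun : hermiteSumTerm κ β s y x =
      fun α => ∏ i, hermiteSumTermOne κ β s y (x i) (α i) :=
    funext (hermiteSumTerm_eq_prod κ β s y x)
  rw [hfun]
  refine ⟨hS, hT.trans ?_⟩
  have hfac : ∀ i, ∑' n, hermiteSumTermOne κ β s y (x i) n ≤
      max C₁ C₂ * if 1 < |x i| then boundFactor κ β s y τ (x i) else 1 := by
    intro i
    split_ifs with hx
    · have := boundFactor_pos (κ := κ) (β := β) (s := s) (y := y) (τ := τ) hx
      exact (h₂ τ hτ _ hx).trans (by gcongr; exact le_max_right _ _)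
    · rw [mul_one]
      exact (h₁ _ (not_lt.1 hx)).trans (le_max_left _ _)
  calc _ ≤ ∏ i, (max C₁ C₂ * if 1 < |x i| then boundFactor κ β s y τ (x i) else 1) :=
        Finset.prod_le_prod
          (fun i _ => tsum_nonneg (hermiteSumTermOne_nonneg κ β s y (x i))) fun i _ => hfac i
    _ = _ := by
      rw [Finset.prod_mul_distrib, Finset.prod_const, Finset.card_univ, Fintype.card_fin,
        Finset.prod_filter]

theorem corollary1p6 (d : ℕ) (κ β s : ℝ) (hκ : 0 < κ) (hs0 : 0 < s) (hs : s < 1 / 2) :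
    (∀ y : ℝ, (2 : ℝ) ^ (1 / (2 * s) - 1) < y →
      ∃ C : ℝ, 0 < C ∧ ∀ x : Fin d → ℝ, x ∉ Set.Icc (-1 : Fin d → ℝ) 1 →
        Summable (hermiteSumTerm κ β s y x) ∧
        ∑' α : Fin d → ℕ+, hermiteSumTerm κ β s y x α ≤
          C * ∏ i with 1 < |x i|, boundFactor κ β s y 1 (x i)) ∧
    (∀ y : ℝ, 0 < y → y ≤ (2 : ℝ) ^ (1 / (2 * s) - 1) →
      ∃ C : ℝ, 0 < C ∧ ∀ θ : ℝ → ℝ,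
        ContinuousOn θ (Set.Ioc 0 ((2 : ℝ) ^ (1 / (2 * s) - 1))) →
        (∀ r ∈ Set.Ioc 0 ((2 : ℝ) ^ (1 / (2 * s) - 1)),
          θ r ∈ Set.Icc (0 : ℝ) 1 ∧ θ r ≤ (2 * r) ^ (2 * s) / 2) →
        ∀ x : Fin d → ℝ, x ∉ Set.Icc (-1 : Fin d → ℝ) 1 →
          Summable (hermiteSumTerm κ β s y x) ∧
          ∑' α : Fin d → ℕ+, hermiteSumTerm κ β s y x α ≤
            C * ∏ i with 1 < |x i|, boundFactor κ β s y (θ y ^ (1 / (2 * s))) (x i)) := by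
  refine ⟨fun y hy => ?_, fun y hy hy2 => ?_⟩
  · have hy0 : 0 < y := lt_trans (by positivity) hy
    obtain ⟨C, hC, h⟩ := exists_tsum_hermiteSumTerm_le d hκ hs0 hs hy0 β
    exact ⟨C, hC, fun x _ => h 1 ⟨zero_le_one, le_rfl⟩ x⟩
  · obtain ⟨C, hC, h⟩ := exists_tsum_hermiteSumTerm_le d hκ hs0 hs hy β
    refine ⟨C, hC, fun θ _ hθ x _ => h _ ?_ x⟩
    obtain ⟨⟨h0, h1⟩, _⟩ := hθ y ⟨hy, hy2⟩
    exact ⟨Real.rpow_nonneg h0 _, Real.rpow_le_one h0 h1 (by positivity)⟩
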